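/- Write $t=(t_1,t_2,\dots)$, $\bar t=(\bar t_1,\bar t_2,\dots)$, $H_0=\mathrm{diag}(1,-1)$, $\Lambda=\begin{bmatrix}0&1\\ \zeta&0\end{bmatrix}$. Let $g_{<0}=I+W_1\Lambda^{-1}+W_2\Lambda^{-2}+\cdots$, $g_0=\mathrm{diag}(e^{\phi},e^{-\phi})$, $g_{>0}=I+\bar W_1\Lambda+\bar W_2\Lambda^2+\cdots$ be functions of $(t,\bar t)$ on some domain, where $W_i,\bar W_i$ are diagonal, $W_1=\mathrm{diag}(q,r)$, $\bar W_1=\mathrm{diag}(\bar q,\bar r)$ and $\det g_{<0}=\det g_{>0}=1$ (for example, a solution of the Sato–Wilson equations of the modified Pohlmeyer–Lund–Regge hierarchy); the domain contains with $(t,\bar t)$ also $(t_\lambda,\bar t_{\lambda^{-1}})$ for $\lambda$ near $1$, where $t_\lambda=(\lambda^nt_n)_n$, $\bar t_{\lambda^{-1}}=(\lambda^{-n}\bar t_n)_n$. The similarity conditions with parameters $\alpha,\beta\in\mathbb C$ are $$g_{<0}(\zeta;t,\bar t)=\lambda^{\alpha H_0}g_{<0}(\lambda^{-1}\zeta;t_\lambda,\bar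 t_{\lambda^{-1}})\lambda^{-\alpha H_0},\quad g_0(t,\bar t)=\lambda^{\alpha H_0}g_0(t_\lambda,\bar t_{\lambda^{-1}})\lambda^{-\beta H_0},\quad g_{>0}(\zeta;t,\bar t)=\lambda^{\beta H_0}g_{>0}(\lambda^{-1}\zeta;t_\lambda,\bar t_{\lambda^{-1}})\lambda^{-\beta H_0},$$ required for complex $\lambda=e^s$ (with $\lambda^a=e^{sa}$) whenever the path $(t_{e^{\sigma s}},\bar t_{e^{-\sigma s}})$, $0\le\sigma\le1$, stays in the domain. Put $S_0=\begin{bmatrix}0&\zeta^{-1}\\-\zeta&0\end{bmatrix}$, $S_1=\begin{bmatrix}0&-1\\1&0\end{bmatrix}$, $P=\begin{bmatrix}0&\zeta^{-1/2}\\-\zeta^{1/2}&0\end{bmatrix}$, $$G_0^{\mathrm L}=\begin{bmatrix}-1/q&0\\ \zeta&-q\end{bmatrix},\ G_1^{\mathrm L}=\begin{bmatrix}-r&1\\0&-1/r\end{bmatrix},\ \bar G_0^{\mathrm L}=\begin{bmatrix}1&0\\-\zeta e^{2\phi}/q&1\end{bmatrix},\ \bar G_1^{\mathrm L}=\begin{bmatrix}1&-1/(re^{2\phi})\\0&1\end{bmatrix},$$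 $$G_0^{\mathrm R}=\begin{bmatrix}1&-\zeta^{-1}e^{2\phi}/\bar r\\0&1\end{bmatrix},\ G_1^{\mathrm R}=\begin{bmatrix}1&0\\-1/(\bar qe^{2\phi})&1\end{bmatrix},\ \bar G_0^{\mathrm R}=\begin{bmatrix}\bar r&-\zeta^{-1}\\0&1/\bar r\end{bmatrix},\ \bar G_1^{\mathrm R}=\begin{bmatrix}1/\bar q&0\\-1&\bar q\end{bmatrix}.$$ The birational transformations $s_i^{\mathrm L}$, $s_i^{\mathrm R}$ ($i=0,1$) and $\pi$ are $$s_i^{\mathrm L}:\ (g_{<0},g_0,g_{>0})(t,\bar t)\mapsto\bigl(G_i^{\mathrm L}g_{<0}S_i,\ G_i^{\mathrm L}g_0(\bar G_i^{\mathrm L})^{-1},\ \bar G_i^{\mathrm L}g_{>0}\bigr)(-t,\bar t),$$ $$s_i^{\mathrm R}:\ (g_{<0},g_0,g_{>0})(t,\bar t)\mapsto\bigl(G_i^{\mathrm R}g_{<0},\ G_i^{\mathrm R}g_0(\bar G_i^{\mathrm R})^{-1},\ \bar G_i^{\mathrm R}g_{>0}S_i\bigr)(t,-\bar t),$$ $$\pi:\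 (g_{<0},g_0,g_{>0})(t,\bar t)\mapsto\bigl(P^{-1}g_{<0}P,\ P^{-1}g_0P,\ P^{-1}g_{>0}P\bigr)(-t,-\bar t),$$ where $s_0^{\mathrm L},s_1^{\mathrm L},s_0^{\mathrm R},s_1^{\mathrm R}$ are defined where $q$, $r$, $\bar r$, $\bar q$, respectively, does not vanish. A product $FG$ of transformations acts on the dependent variables by substitution, $(FG)(x)=F(G(x))$; that is, the values of the variables are transformed by $F$ first. Then the shift operators $T_{\mathrm L}=s_0^{\mathrm L}s_1^{\mathrm L}$, $T_{\mathrm R}=s_0^{\mathrm R}s_1^{\mathrm R}$, $\mathcal T_1=s_0^{\mathrm R}s_0^{\mathrm L}\pi$ and $\mathcal T_2=s_1^{\mathrm R}s_0^{\mathrm L}\pi$ act on the parameters by $$T_{\mathrm L}:(\alpha,\beta)\mapsto(\alpha+1,\beta),\quad T_{\mathrm R}:(\alpha,\beta)\mapsto(\alpha,\beta+1),\quad \mathcal T_1:(\alpha,\beta)\mapsto(\alpha+\tfrac12,\beta+\tfrac12),\quad \mathcal T_2:(\alpha,\beta)\mapsto(\alpha+\tfrac12,\beta-\tfrac12).$$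 That is: if $(g_{<0},g_0,g_{>0})$ satisfies the similarity conditions with parameters $(\alpha,\beta)$, its image is again of the above form, on a domain with the same property, and it satisfies the similarity conditions with the shifted parameters and, if its domain is non-empty, with no others. -/

import Mathlib

noncomputable section

namespace MPLR

/-- The times `(t, t̄)` with `t = (t₁, t₂, …)` and `t̄ = (t̄₁, t̄₂, …)`. -/
abbrev Times : Type := (ℕ+ → ℂ) × (ℕ+ → ℂ)

/-- `(t, t̄) ↦ (-t, t̄)` -/
def flipL (p : Times) : Times := (-p.1, p.2)

/-- `(t, t̄) ↦ (t, -t̄)` -/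
def flipR (p : Times) : Times := (p.1, -p.2)

/-- `(t, t̄) ↦ (t_λ, t̄_{λ⁻¹})`, where `t_λ = (λ t₁, λ² t₂, …)`,
`t̄_{λ⁻¹} = (λ⁻¹ t̄₁, λ⁻² t̄₂, …)`. -/
def scale (lam : ℂ) (p : Times) : Times :=
  (fun n => lam ^ (n : ℕ) * p.1 n, fun n => lam⁻¹ ^ (n : ℕ) * p.2 n)

/-- `2 × 2` matrices of formal Laurent series in one variable `X`. -/
abbrev Mat : Type := Matrix (Fin 2) (Fin 2) (LaurentSeries ℂ)

/-- A constant, as a Laurent series. -/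
abbrev cst (a : ℂ) : LaurentSeries ℂ := HahnSeries.C a

/-- The spectral parameter `ζ` in the field `ℂ((ζ))`, where `X = ζ`. -/
def zetaPos : LaurentSeries ℂ := HahnSeries.single 1 1

/-- The spectral parameter `ζ` in the field `ℂ((ζ⁻¹))`, where `X = ζ⁻¹`. -/
def zetaNeg : LaurentSeries ℂ := HahnSeries.single (-1) 1

/-- Substitution `X ↦ c X` in a Laurent series. -/
def rescale (c : ℂ) (f : LaurentSeries ℂ) : LaurentSeries ℂ where
  coeff n := c ^ n * f.coeff n
  isPWO_support' := f.isPWO_support'.mono (by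
    intro n hn
    simp only [Function.mem_support] at hn ⊢
    exact right_ne_zero_of_mul hn)

/-- `λ^{a H₀} = diag(λ^a, λ^{-a})` for `λ = e^s`. -/
def powH (s a : ℂ) : Mat :=
  !![cst (Complex.exp (s * a)), 0; 0, cst (Complex.exp (-(s * a)))]

/-- The dependent variables `g_{<0}, g₀, g_{>0}` as functions of the times on a domain `dom`
(the values outside `dom` play no role). The matrix `g_{<0}` is a series in `X = ζ⁻¹`;
the matrices `g₀` and `g_{>0}` are series in `X = ζ`. -/
structure Data where
  dom : Set Times
  gneg : Times → Mat
  gzero : Times → Mat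
  gpos : Times → Mat

namespace Data

/-- `q`: `g_{<0} = I + diag(q, r) Λ⁻¹ + ⋯`, where `Λ⁻¹ = [0, ζ⁻¹; 1, 0]`. -/
def q (g : Data) (p : Times) : ℂ := (g.gneg p 0 1).coeff 1
/-- `r`: `g_{<0} = I + diag(q, r) Λ⁻¹ + ⋯`. -/
def r (g : Data) (p : Times) : ℂ := (g.gneg p 1 0).coeff 0
/-- `q̄`: `g_{>0} = I + diag(q̄, r̄) Λ + ⋯`, where `Λ = [0, 1; ζ, 0]`. -/
def qbar (g : Data) (p : Times) : ℂ := (g.gpos p 0 1).coeff 0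
/-- `r̄`: `g_{>0} = I + diag(q̄, r̄) Λ + ⋯`. -/
def rbar (g : Data) (p : Times) : ℂ := (g.gpos p 1 0).coeff 1
/-- `e^φ`: `g₀ = diag(e^φ, e^{-φ})`. -/
def ephi (g : Data) (p : Times) : ℂ := (g.gzero p 0 0).coeff 0

/-- At every time of the domain, `g_{<0}, g₀, g_{>0}` are factors of a Gauss decomposition in
the loop group of `SL₂`:
`g_{<0} = I + W₁ Λ⁻¹ + W₂ Λ⁻² + ⋯` and `g_{>0} = I + W̄₁ Λ + W̄₂ Λ² + ⋯` with diagonal complex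
matrices `W_i, W̄_i` (here written out entry by entry, using `Λ² = ζ I`) and determinant `1`, and
`g₀ = diag(e^φ, e^{-φ})`. -/
structure IsGauss (g : Data) : Prop where
  neg_det : ∀ p ∈ g.dom, (g.gneg p).det = 1
  neg_diag : ∀ p ∈ g.dom, ∀ i, (g.gneg p i i).coeff 0 = 1 ∧ ∀ n < 0, (g.gneg p i i).coeff n = 0
  neg_upper : ∀ p ∈ g.dom, ∀ n ≤ 0, (g.gneg p 0 1).coeff n = 0
  neg_lower : ∀ p ∈ g.dom, ∀ n < 0, (g.gneg p 1 0).coeff n = 0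
  zero_form : ∀ p ∈ g.dom, ∃ u : ℂ, u ≠ 0 ∧ g.gzero p = !![cst u, 0; 0, cst u⁻¹]
  pos_det : ∀ p ∈ g.dom, (g.gpos p).det = 1
  pos_diag : ∀ p ∈ g.dom, ∀ i, (g.gpos p i i).coeff 0 = 1 ∧ ∀ n < 0, (g.gpos p i i).coeff n = 0
  pos_upper : ∀ p ∈ g.dom, ∀ n < 0, (g.gpos p 0 1).coeff n = 0
  pos_lower : ∀ p ∈ g.dom, ∀ n ≤ 0, (g.gpos p 1 0).coeff n = 0

/-- The domain is open along the orbits of the scaling: with `(t, t̄)` it contains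
`(t_λ, t̄_{λ⁻¹})` for all complex `λ` near `1`. This holds for an open domain in any finite number
of times, the other times being `0`. -/
def ScaleOpen (g : Data) : Prop :=
  ∀ p ∈ g.dom, ∀ᶠ s in nhds (0 : ℂ), scale (Complex.exp s) p ∈ g.dom

/-- The similarity conditions with parameters `(α, β)`:
`g_{<0}(ζ; t, t̄) = λ^{α H₀} g_{<0}(λ⁻¹ ζ; t_λ, t̄_{λ⁻¹}) λ^{-α H₀}`,
`g₀(t, t̄) = λ^{α H₀} g₀(t_λ, t̄_{λ⁻¹}) λ^{-β H₀}`,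
`g_{>0}(ζ; t, t̄) = λ^{β H₀} g_{>0}(λ⁻¹ ζ; t_λ, t̄_{λ⁻¹}) λ^{-β H₀}`.
The powers of the complex number `λ` are multivalued; we write `λ = e^s`, and move from `(t, t̄)` to
`(t_λ, t̄_{λ⁻¹})` inside the domain along the path given by `e^{σ s}`, `0 ≤ σ ≤ 1`. -/
def Similar (g : Data) (α β : ℂ) : Prop :=
  ∀ p ∈ g.dom, ∀ s : ℂ,
    (∀ σ ∈ Set.Icc (0 : ℝ) 1, scale (Complex.exp (σ * s)) p ∈ g.dom) →
    g.gneg p = powH s α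
        * (g.gneg (scale (Complex.exp s) p)).map (rescale (Complex.exp s)) * powH s (-α) ∧
    g.gzero p = powH s α * g.gzero (scale (Complex.exp s) p) * powH s (-β) ∧
    g.gpos p = powH s β
        * (g.gpos (scale (Complex.exp s) p)).map (rescale (Complex.exp (-s))) * powH s (-β)

end Data

/-- `S₀` -/
def S0 (z : LaurentSeries ℂ) : Mat := !![0, z⁻¹; -z, 0]
/-- `S₁` -/
def S1 : Mat := !![0, -1; 1, 0]

/-- `G₀ᴸ` -/
def GL0 (z : LaurentSeries ℂ) (q : ℂ) : Mat := !![cst (-1 / q), 0; z, cst (-q)]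
/-- `G₁ᴸ` -/
def GL1 (r : ℂ) : Mat := !![cst (-r), 1; 0, cst (-1 / r)]
/-- `Ḡ₀ᴸ`, with `u = e^φ` -/
def GbarL0 (z : LaurentSeries ℂ) (u q : ℂ) : Mat := !![1, 0; -z * cst (u ^ 2 / q), 1]
/-- `Ḡ₁ᴸ`, with `u = e^φ`; the sign is the one for which `G₁ᴸ g₀ (Ḡ₁ᴸ)⁻¹` is diagonal. -/
def GbarL1 (u r : ℂ) : Mat := !![1, cst (-1 / (r * u ^ 2)); 0, 1]

/-- `G₀ᴿ`, with `u = e^φ` -/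
def GR0 (z : LaurentSeries ℂ) (u rbar : ℂ) : Mat := !![1, -z⁻¹ * cst (u ^ 2 / rbar); 0, 1]
/-- `G₁ᴿ`, with `u = e^φ` -/
def GR1 (u qbar : ℂ) : Mat := !![1, 0; cst (-1 / (qbar * u ^ 2)), 1]
/-- `Ḡ₀ᴿ` -/
def GbarR0 (z : LaurentSeries ℂ) (rbar : ℂ) : Mat := !![cst rbar, -z⁻¹; 0, cst (1 / rbar)]
/-- `Ḡ₁ᴿ` -/
def GbarR1 (qbar : ℂ) : Mat := !![cst (1 / qbar), 0; -1, cst qbar]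

/-- `ζ^{1/2} P` for the matrix `P = [0, ζ^{-1/2}; -ζ^{1/2}, 0]`. The scalar factor `ζ^{1/2}`
has no effect on the conjugation `g ↦ P⁻¹ g P`. -/
def Pmat (z : LaurentSeries ℂ) : Mat := !![0, 1; -z, 0]

/-- The left action `s₀ᴸ`. It is a birational transformation, defined where `q ≠ 0`. -/
def sL0 (g : Data) : Data where
  dom := {p | flipL p ∈ g.dom ∧ g.q (flipL p) ≠ 0}
  gneg p := GL0 zetaNeg (g.q (flipL p)) * g.gneg (flipL p) * S0 zetaNeg
  gzero p := GL0 zetaPos (g.q (flipL p)) * g.gzero (flipL p)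
    * (GbarL0 zetaPos (g.ephi (flipL p)) (g.q (flipL p)))⁻¹
  gpos p := GbarL0 zetaPos (g.ephi (flipL p)) (g.q (flipL p)) * g.gpos (flipL p)

/-- The left action `s₁ᴸ`, defined where `r ≠ 0`. -/
def sL1 (g : Data) : Data where
  dom := {p | flipL p ∈ g.dom ∧ g.r (flipL p) ≠ 0}
  gneg p := GL1 (g.r (flipL p)) * g.gneg (flipL p) * S1
  gzero p := GL1 (g.r (flipL p)) * g.gzero (flipL p)
    * (GbarL1 (g.ephi (flipL p)) (g.r (flipL p)))⁻¹
  gpos p := GbarL1 (g.ephi (flipL p)) (g.r (flipL p)) * g.gpos (flipL p)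

/-- The right action `s₀ᴿ`, defined where `r̄ ≠ 0`. -/
def sR0 (g : Data) : Data where
  dom := {p | flipR p ∈ g.dom ∧ g.rbar (flipR p) ≠ 0}
  gneg p := GR0 zetaNeg (g.ephi (flipR p)) (g.rbar (flipR p)) * g.gneg (flipR p)
  gzero p := GR0 zetaPos (g.ephi (flipR p)) (g.rbar (flipR p)) * g.gzero (flipR p)
    * (GbarR0 zetaPos (g.rbar (flipR p)))⁻¹
  gpos p := GbarR0 zetaPos (g.rbar (flipR p)) * g.gpos (flipR p) * S0 zetaPos

/-- The right action `s₁ᴿ`, defined where `q̄ ≠ 0`. -/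
def sR1 (g : Data) : Data where
  dom := {p | flipR p ∈ g.dom ∧ g.qbar (flipR p) ≠ 0}
  gneg p := GR1 (g.ephi (flipR p)) (g.qbar (flipR p)) * g.gneg (flipR p)
  gzero p := GR1 (g.ephi (flipR p)) (g.qbar (flipR p)) * g.gzero (flipR p)
    * (GbarR1 (g.qbar (flipR p)))⁻¹
  gpos p := GbarR1 (g.qbar (flipR p)) * g.gpos (flipR p) * S1

/-- The Dynkin diagram automorphism `π`. -/
def dynkin (g : Data) : Data where
  dom := {p | -p ∈ g.dom}
  gneg p := (Pmat zetaNeg)⁻¹ * g.gneg (-p) * Pmat zetaNeg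
  gzero p := (Pmat zetaPos)⁻¹ * g.gzero (-p) * Pmat zetaPos
  gpos p := (Pmat zetaPos)⁻¹ * g.gpos (-p) * Pmat zetaPos

/-- The product `F G` of two transformations. Transformations act on the dependent variables by
substitution, so `(F G)(x) = F (G (x))` means: express `G (x)` through the dependent variables, and
replace these by their images under `F`. In terms of the values of the dependent variables, `F` is
thus applied first. For instance
`(s₀ᴸ s₁ᴸ)(g_{<0}) = s₀ᴸ(G₁ᴸ) s₀ᴸ(g_{<0}) S₁ = s₀ᴸ(G₁ᴸ) G₀ᴸ g_{<0} S₀ S₁` up to signs of times. -/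
def comp (F G : Data → Data) : Data → Data := fun g => G (F g)

/-- `T_L = s₀ᴸ s₁ᴸ` -/
def TL : Data → Data := comp sL0 sL1
/-- `T_R = s₀ᴿ s₁ᴿ` -/
def TR : Data → Data := comp sR0 sR1
/-- `𝒯₁ = s₀ᴿ s₀ᴸ π` -/
def T1 : Data → Data := comp (comp sR0 sL0) dynkin
/-- `𝒯₂ = s₁ᴿ s₀ᴸ π` -/
def T2 : Data → Data := comp (comp sR1 sL0) dynkin

/-- The transformation `T` acts on the parameters of the similarity conditions by
`(α, β) ↦ (α + a, β + b)`: it sends variables that satisfy the conditions with parameters `(α, β)`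
to variables of the same kind that satisfy them with `(α + a, β + b)`, and (wherever the image is
defined at all) with no other parameters. -/
def ShiftsParametersBy (T : Data → Data) (a b : ℂ) : Prop :=
  ∀ (g : Data) (α β : ℂ), g.IsGauss → g.ScaleOpen → g.Similar α β →
    (T g).IsGauss ∧ (T g).ScaleOpen ∧ (T g).Similar (α + a) (β + b) ∧
    ((T g).dom.Nonempty → ∀ α' β' : ℂ, (T g).Similar α' β' → α' = α + a ∧ β' = β + b)

end MPLR

end

noncomputable section

namespace MPLR

/-! Conjugation by λ^{αH₀} fixes diagonal entries and multiplies the off-diagonal ones by λ^{±2α}.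
The similarity conditions are therefore entrywise homogeneity statements (`Intertwined`,
`intertwined_iff`): the matrix at a time is the rescaled matrix at the scaled time, up to a weight w
= λ^{2α} for g_{<0} and v = λ^{2β} for g_{>0}, while e^φ has weight λ^{α-β}. Reading off leading
coefficients, q, r, q̄, r̄ have weights λ^{2α+1}, λ^{-2α}, λ^{2β}, λ^{-2β-1}.

The entries of the matrices G and Ḡ are monomials in these variables and ζ, of exactly the weights
that keep the products homogeneous. So every generator carries similar data to similar data
(`Admissible.sL0` and its companions), acting on the parameters by a reflection: s₀ᴸ by α ↦ -α-1,
s₁ᴸ by α ↦ -α, s₀ᴿ by β ↦ -β-1, s₁ᴿ by β ↦ -β, and π by (α,β) ↦ (-α-1/2, -β-1/2). The shifts are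
compositions of these. The Gauss form survives because each G is built to cancel the one leading
coefficient that would violate it.

Uniqueness: e^φ never vanishes, so its weight determines α-β. The last generators applied leave a
nonvanishing variable in the image: r = -1/r_old after s₁ᴸ, q̄ = -1/q̄_old after s₁ᴿ, r = 1/q_old
after s₀ᴸ followed by π. Its weight determines α or β, since e^{sa} = e^{sb} for all s near 0 forces
a = b. -/

/-- The substitution `X ↦ c X`, for `c ≠ 0`, as a ring homomorphism. -/
def rescaleHom (c : ℂ) (hc : c ≠ 0) : LaurentSeries ℂ →+* LaurentSeries ℂ where
  toFun := rescale c
  map_one' := by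
    ext n
    by_cases hn : n = 0 <;> simp [rescale, HahnSeries.coeff_one, hn]
  map_zero' := by
    ext n
    simp [rescale]
  map_add' f g := by
    ext n
    simp [rescale, mul_add]
  map_mul' f g := by
    ext n
    -- Since c ≠ 0, the supports do not change, so both convolution sums run over the same index set
    -- and c^(i+j) = c^i c^j compares them term by term.
    have hs : ∀ h : LaurentSeries ℂ, (rescale c h).support = h.support := fun h => by
      ext m
      simp [rescale, zpow_ne_zero m hc]
    simp only [HahnSeries.coeff_mul, hs]
    simp only [rescale, HahnSeries.coeff_mul, Finset.mul_sum]
    refine Finset.sum_congr rfl fun ij hij => ?_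
    rw [← (Finset.mem_antidiagonal.mp hij).2.2, zpow_add₀ hc]
    ring

theorem coeff_rescaleHom (c : ℂ) (hc : c ≠ 0) (f : LaurentSeries ℂ) (n : ℤ) :
    (rescaleHom c hc f).coeff n = c ^ n * f.coeff n := rfl

@[simp]
theorem rescaleHom_single (c : ℂ) (hc : c ≠ 0) (n : ℤ) (a : ℂ) :
    rescaleHom c hc (HahnSeries.single n a) = HahnSeries.single n (c ^ n * a) := by
  ext m
  by_cases hm : m = n <;> simp [coeff_rescaleHom, hm]

/-! ### Gauss factors at one time, and explicit products with the matrices G, Ḡ, S, P -/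

/-- The conditions on `g_{<0}` at a single time. -/
structure IsNegFactor (M : Mat) : Prop where
  det : M.det = 1
  diag : ∀ i, (M i i).coeff 0 = 1 ∧ ∀ n < 0, (M i i).coeff n = 0
  upper : ∀ n ≤ 0, (M 0 1).coeff n = 0
  lower : ∀ n < 0, (M 1 0).coeff n = 0

/-- The conditions on `g_{>0}` at a single time. -/
structure IsPosFactor (M : Mat) : Prop where
  det : M.det = 1
  diag : ∀ i, (M i i).coeff 0 = 1 ∧ ∀ n < 0, (M i i).coeff n = 0
  upper : ∀ n < 0, (M 0 1).coeff n = 0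
  lower : ∀ n ≤ 0, (M 1 0).coeff n = 0

theorem zetaPos_inv : zetaPos⁻¹ = HahnSeries.single (-1) 1 := by
  simp [zetaPos, HahnSeries.inv_single]

theorem zetaNeg_inv : zetaNeg⁻¹ = HahnSeries.single 1 1 := by
  simp [zetaNeg, HahnSeries.inv_single]

theorem zetaPos_ne_zero : zetaPos ≠ 0 := by simp [zetaPos]

theorem zetaNeg_ne_zero : zetaNeg ≠ 0 := by simp [zetaNeg]

theorem cst_ne_zero {a : ℂ} (ha : a ≠ 0) : cst a ≠ 0 := by simpa using ha

theorem det_S0 {z : LaurentSeries ℂ} (hz : z ≠ 0) : (S0 z).det = 1 := by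
  rw [S0, Matrix.det_fin_two_of]
  field_simp
  ring

theorem det_S1 : S1.det = 1 := by simp [S1, Matrix.det_fin_two_of]

theorem det_GL0 (z : LaurentSeries ℂ) {q : ℂ} (hq : q ≠ 0) : (GL0 z q).det = 1 := by
  rw [GL0, Matrix.det_fin_two_of, ← map_mul, show -1 / q * -q = 1 by field_simp]
  simp

theorem det_GL1 {r : ℂ} (hr : r ≠ 0) : (GL1 r).det = 1 := by
  rw [GL1, Matrix.det_fin_two_of, ← map_mul, show -r * (-1 / r) = 1 by field_simp]
  simp

theorem det_GbarL0 (z : LaurentSeries ℂ) (u q : ℂ) : (GbarL0 z u q).det = 1 := by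
  simp [GbarL0, Matrix.det_fin_two_of]

theorem det_GbarL1 (u r : ℂ) : (GbarL1 u r).det = 1 := by
  simp [GbarL1, Matrix.det_fin_two_of]

theorem det_GR0 (z : LaurentSeries ℂ) (u r : ℂ) : (GR0 z u r).det = 1 := by
  simp [GR0, Matrix.det_fin_two_of]

theorem det_GR1 (u q : ℂ) : (GR1 u q).det = 1 := by
  simp [GR1, Matrix.det_fin_two_of]

theorem det_GbarR0 (z : LaurentSeries ℂ) {r : ℂ} (hr : r ≠ 0) : (GbarR0 z r).det = 1 := by
  simp [GbarR0, Matrix.det_fin_two_of, hr]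

theorem det_GbarR1 {q : ℂ} (hq : q ≠ 0) : (GbarR1 q).det = 1 := by
  simp [GbarR1, Matrix.det_fin_two_of, hq]

theorem det_Pmat (z : LaurentSeries ℂ) : (Pmat z).det = z := by
  simp [Pmat, Matrix.det_fin_two_of]

theorem mat_ext {a b c d a' b' c' d' : LaurentSeries ℂ} (ha : a = a') (hb : b = b') (hc : c = c')
    (hd : d = d') : !![a, b; c, d] = (!![a', b'; c', d'] : Mat) := by
  rw [ha, hb, hc, hd]

theorem Pmat_inv {z : LaurentSeries ℂ} (hz : z ≠ 0) : (Pmat z)⁻¹ = !![0, -z⁻¹; 1, 0] := by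
  refine Matrix.inv_eq_right_inv ?_
  rw [Pmat, Matrix.mul_fin_two, Matrix.one_fin_two]
  refine mat_ext ?_ ?_ ?_ ?_ <;> field_simp <;> ring

theorem Pmat_conj {z : LaurentSeries ℂ} (hz : z ≠ 0) (M : Mat) :
    (Pmat z)⁻¹ * M * Pmat z = !![M 1 1, -(z⁻¹ * M 1 0); -(z * M 0 1), M 0 0] := by
  rw [Pmat_inv hz]
  nth_rw 1 [Matrix.eta_fin_two M]
  rw [Pmat, Matrix.mul_fin_two, Matrix.mul_fin_two]
  refine mat_ext ?_ ?_ ?_ ?_ <;> field_simp <;> ring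

theorem leftZero_mul (z : LaurentSeries ℂ) (hz : z ≠ 0) (q : ℂ) (M : Mat) :
    GL0 z q * M * S0 z = !![-(z * (cst (-1 / q) * M 0 1)), z⁻¹ * (cst (-1 / q) * M 0 0);
      -(z * (z * M 0 1)) - z * (cst (-q) * M 1 1), M 0 0 + z⁻¹ * (cst (-q) * M 1 0)] := by
  nth_rw 1 [Matrix.eta_fin_two M]
  rw [GL0, S0, Matrix.mul_fin_two, Matrix.mul_fin_two]
  refine mat_ext ?_ ?_ ?_ ?_ <;> field_simp <;> ring

theorem leftOne_mul (r : ℂ) (M : Mat) :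
    GL1 r * M * S1 = !![cst (-r) * M 0 1 + M 1 1, -(cst (-r) * M 0 0) - M 1 0;
      cst (-1 / r) * M 1 1, -(cst (-1 / r) * M 1 0)] := by
  nth_rw 1 [Matrix.eta_fin_two M]
  rw [GL1, S1, Matrix.mul_fin_two, Matrix.mul_fin_two]
  refine mat_ext ?_ ?_ ?_ ?_ <;> ring

theorem GbarL0_mul (z : LaurentSeries ℂ) (u q : ℂ) (M : Mat) :
    GbarL0 z u q * M = !![M 0 0, M 0 1; M 1 0 - z * (cst (u ^ 2 / q) * M 0 0),
      M 1 1 - z * (cst (u ^ 2 / q) * M 0 1)] := by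
  nth_rw 1 [Matrix.eta_fin_two M]
  rw [GbarL0, Matrix.mul_fin_two]
  refine mat_ext ?_ ?_ ?_ ?_ <;> ring

theorem GbarL1_mul (u r : ℂ) (M : Mat) :
    GbarL1 u r * M = !![M 0 0 + cst (-1 / (r * u ^ 2)) * M 1 0,
      M 0 1 + cst (-1 / (r * u ^ 2)) * M 1 1; M 1 0, M 1 1] := by
  nth_rw 1 [Matrix.eta_fin_two M]
  rw [GbarL1, Matrix.mul_fin_two]
  refine mat_ext ?_ ?_ ?_ ?_ <;> ring

theorem GR0_mul (z : LaurentSeries ℂ) (u r : ℂ) (M : Mat) :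
    GR0 z u r * M = !![M 0 0 - z⁻¹ * (cst (u ^ 2 / r) * M 1 0),
      M 0 1 - z⁻¹ * (cst (u ^ 2 / r) * M 1 1); M 1 0, M 1 1] := by
  nth_rw 1 [Matrix.eta_fin_two M]
  rw [GR0, Matrix.mul_fin_two]
  refine mat_ext ?_ ?_ ?_ ?_ <;> ring

theorem GR1_mul (u q : ℂ) (M : Mat) :
    GR1 u q * M = !![M 0 0, M 0 1; M 1 0 + cst (-1 / (q * u ^ 2)) * M 0 0,
      M 1 1 + cst (-1 / (q * u ^ 2)) * M 0 1] := by
  nth_rw 1 [Matrix.eta_fin_two M]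
  rw [GR1, Matrix.mul_fin_two]
  refine mat_ext ?_ ?_ ?_ ?_ <;> ring

theorem rightZero_mul (z : LaurentSeries ℂ) (hz : z ≠ 0) (r : ℂ) (M : Mat) :
    GbarR0 z r * M * S0 z = !![M 1 1 - z * (cst r * M 0 1),
      z⁻¹ * (cst r * M 0 0) - z⁻¹ * (z⁻¹ * M 1 0);
      -(z * (cst (1 / r) * M 1 1)), z⁻¹ * (cst (1 / r) * M 1 0)] := by
  nth_rw 1 [Matrix.eta_fin_two M]
  rw [GbarR0, S0, Matrix.mul_fin_two, Matrix.mul_fin_two]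
  refine mat_ext ?_ ?_ ?_ ?_ <;> field_simp <;> ring

theorem rightOne_mul (q : ℂ) (M : Mat) :
    GbarR1 q * M * S1 = !![cst (1 / q) * M 0 1, -(cst (1 / q) * M 0 0);
      cst q * M 1 1 - M 0 1, M 0 0 - cst q * M 1 0] := by
  nth_rw 1 [Matrix.eta_fin_two M]
  rw [GbarR1, S1, Matrix.mul_fin_two, Matrix.mul_fin_two]
  refine mat_ext ?_ ?_ ?_ ?_ <;> ring

theorem coeff_cst_mul (a : ℂ) (f : LaurentSeries ℂ) (n : ℤ) :
    (cst a * f).coeff n = a * f.coeff n := by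
  simp [HahnSeries.C_apply]

theorem coeff_zetaPos_mul (f : LaurentSeries ℂ) (n : ℤ) :
    (zetaPos * f).coeff n = f.coeff (n - 1) := by
  simp [zetaPos, HahnSeries.coeff_single_mul]

theorem coeff_zetaNeg_mul (f : LaurentSeries ℂ) (n : ℤ) :
    (zetaNeg * f).coeff n = f.coeff (n + 1) := by
  simp [zetaNeg, HahnSeries.coeff_single_mul]

theorem coeff_zetaPos_inv_mul (f : LaurentSeries ℂ) (n : ℤ) :
    (zetaPos⁻¹ * f).coeff n = f.coeff (n + 1) := by
  simp [zetaPos_inv, HahnSeries.coeff_single_mul]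

theorem coeff_zetaNeg_inv_mul (f : LaurentSeries ℂ) (n : ℤ) :
    (zetaNeg⁻¹ * f).coeff n = f.coeff (n - 1) := by
  simp [zetaNeg_inv, HahnSeries.coeff_single_mul]

/-! ### The transformations preserve the form of the Gauss factors -/

section factors

set_option linter.unusedSimpArgs false

variable {M : Mat}

/-- The only dangerous term is the coefficient of ζ in the lower left entry, which is -q + q = 0
because the diagonal of M starts with 1. The factor -1/q normalizes the upper left entry. -/
theorem IsNegFactor.leftZero (h : IsNegFactor M) (hq : (M 0 1).coeff 1 ≠ 0) :
    IsNegFactor (GL0 zetaNeg ((M 0 1).coeff 1) * M * S0 zetaNeg) := by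
  obtain ⟨hd, hdi, hu, hl⟩ := h
  obtain ⟨h0, h0'⟩ := hdi 0
  obtain ⟨h1, h1'⟩ := hdi 1
  refine ⟨by simp [Matrix.det_mul, hd, det_GL0 _ hq, det_S0 zetaNeg_ne_zero],
    Fin.forall_fin_two.2 ⟨⟨?_, fun n hn => ?_⟩, ?_, fun n hn => ?_⟩,
    fun n hn => ?_, fun n hn => ?_⟩ <;>
  simp only [leftZero_mul _ zetaNeg_ne_zero,
    Matrix.of_apply, Matrix.cons_val', Matrix.cons_val_zero, Matrix.cons_val_one,
    Matrix.cons_val_fin_one, HahnSeries.coeff_add, HahnSeries.coeff_sub, HahnSeries.coeff_neg,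
    coeff_cst_mul,
    coeff_zetaNeg_mul, coeff_zetaNeg_inv_mul] <;>
  grind

/-- Here the cancellation is r - r = 0, in the constant term of the upper right entry. -/
theorem IsNegFactor.leftOne (h : IsNegFactor M) (hr : (M 1 0).coeff 0 ≠ 0) :
    IsNegFactor (GL1 ((M 1 0).coeff 0) * M * S1) := by
  obtain ⟨hd, hdi, hu, hl⟩ := h
  obtain ⟨h0, h0'⟩ := hdi 0
  obtain ⟨h1, h1'⟩ := hdi 1
  refine ⟨by simp [Matrix.det_mul, hd, det_GL1 hr, det_S1],
    Fin.forall_fin_two.2 ⟨⟨?_, fun n hn => ?_⟩, ?_, fun n hn => ?_⟩,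
    fun n hn => ?_, fun n hn => ?_⟩ <;>
  simp only [leftOne_mul,
    Matrix.of_apply, Matrix.cons_val', Matrix.cons_val_zero, Matrix.cons_val_one,
    Matrix.cons_val_fin_one, HahnSeries.coeff_add, HahnSeries.coeff_sub, HahnSeries.coeff_neg,
    coeff_cst_mul,
    coeff_zetaNeg_mul, coeff_zetaNeg_inv_mul] <;>
  grind

/-- The coefficient of ζ⁻¹ in the upper right entry is r̄ - r̄ = 0. -/
theorem IsPosFactor.rightZero (h : IsPosFactor M) (hr : (M 1 0).coeff 1 ≠ 0) :
    IsPosFactor (GbarR0 zetaPos ((M 1 0).coeff 1) * M * S0 zetaPos) := by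
  obtain ⟨hd, hdi, hu, hl⟩ := h
  obtain ⟨h0, h0'⟩ := hdi 0
  obtain ⟨h1, h1'⟩ := hdi 1
  refine ⟨by simp [Matrix.det_mul, hd, det_GbarR0 _ hr, det_S0 zetaPos_ne_zero],
    Fin.forall_fin_two.2 ⟨⟨?_, fun n hn => ?_⟩, ?_, fun n hn => ?_⟩,
    fun n hn => ?_, fun n hn => ?_⟩ <;>
  simp only [rightZero_mul _ zetaPos_ne_zero,
    Matrix.of_apply, Matrix.cons_val', Matrix.cons_val_zero, Matrix.cons_val_one,
    Matrix.cons_val_fin_one, HahnSeries.coeff_add, HahnSeries.coeff_sub, HahnSeries.coeff_neg,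
    coeff_cst_mul,
    coeff_zetaPos_mul, coeff_zetaPos_inv_mul] <;>
  grind

/-- The constant term of the lower left entry is q̄ - q̄ = 0. -/
theorem IsPosFactor.rightOne (h : IsPosFactor M) (hq : (M 0 1).coeff 0 ≠ 0) :
    IsPosFactor (GbarR1 ((M 0 1).coeff 0) * M * S1) := by
  obtain ⟨hd, hdi, hu, hl⟩ := h
  obtain ⟨h0, h0'⟩ := hdi 0
  obtain ⟨h1, h1'⟩ := hdi 1
  refine ⟨by simp [Matrix.det_mul, hd, det_GbarR1 hq, det_S1],
    Fin.forall_fin_two.2 ⟨⟨?_, fun n hn => ?_⟩, ?_, fun n hn => ?_⟩,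
    fun n hn => ?_, fun n hn => ?_⟩ <;>
  simp only [rightOne_mul,
    Matrix.of_apply, Matrix.cons_val', Matrix.cons_val_zero, Matrix.cons_val_one,
    Matrix.cons_val_fin_one, HahnSeries.coeff_add, HahnSeries.coeff_sub, HahnSeries.coeff_neg,
    coeff_cst_mul,
    coeff_zetaPos_mul, coeff_zetaPos_inv_mul] <;>
  grind

/-- The multiplier is itself a unipotent factor of positive type, so no cancellation is needed and
any constants will do. The same holds for the next three lemmas, with negative type for the right
actions. -/
theorem IsPosFactor.leftZero (h : IsPosFactor M) (u q : ℂ) :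
    IsPosFactor (GbarL0 zetaPos u q * M) := by
  obtain ⟨hd, hdi, hu, hl⟩ := h
  obtain ⟨h0, h0'⟩ := hdi 0
  obtain ⟨h1, h1'⟩ := hdi 1
  refine ⟨by simp [Matrix.det_mul, hd, det_GbarL0],
    Fin.forall_fin_two.2 ⟨⟨?_, fun n hn => ?_⟩, ?_, fun n hn => ?_⟩,
    fun n hn => ?_, fun n hn => ?_⟩ <;>
  simp only [GbarL0_mul,
    Matrix.of_apply, Matrix.cons_val', Matrix.cons_val_zero, Matrix.cons_val_one,
    Matrix.cons_val_fin_one, HahnSeries.coeff_add, HahnSeries.coeff_sub, HahnSeries.coeff_neg,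
    coeff_cst_mul,
    coeff_zetaPos_mul, coeff_zetaPos_inv_mul] <;>
  grind

theorem IsPosFactor.leftOne (h : IsPosFactor M) (u r : ℂ) :
    IsPosFactor (GbarL1 u r * M) := by
  obtain ⟨hd, hdi, hu, hl⟩ := h
  obtain ⟨h0, h0'⟩ := hdi 0
  obtain ⟨h1, h1'⟩ := hdi 1
  refine ⟨by simp [Matrix.det_mul, hd, det_GbarL1],
    Fin.forall_fin_two.2 ⟨⟨?_, fun n hn => ?_⟩, ?_, fun n hn => ?_⟩,
    fun n hn => ?_, fun n hn => ?_⟩ <;>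
  simp only [GbarL1_mul,
    Matrix.of_apply, Matrix.cons_val', Matrix.cons_val_zero, Matrix.cons_val_one,
    Matrix.cons_val_fin_one, HahnSeries.coeff_add, HahnSeries.coeff_sub, HahnSeries.coeff_neg,
    coeff_cst_mul,
    coeff_zetaPos_mul, coeff_zetaPos_inv_mul] <;>
  grind

theorem IsNegFactor.rightZero (h : IsNegFactor M) (u r : ℂ) :
    IsNegFactor (GR0 zetaNeg u r * M) := by
  obtain ⟨hd, hdi, hu, hl⟩ := h
  obtain ⟨h0, h0'⟩ := hdi 0
  obtain ⟨h1, h1'⟩ := hdi 1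
  refine ⟨by simp [Matrix.det_mul, hd, det_GR0],
    Fin.forall_fin_two.2 ⟨⟨?_, fun n hn => ?_⟩, ?_, fun n hn => ?_⟩,
    fun n hn => ?_, fun n hn => ?_⟩ <;>
  simp only [GR0_mul,
    Matrix.of_apply, Matrix.cons_val', Matrix.cons_val_zero, Matrix.cons_val_one,
    Matrix.cons_val_fin_one, HahnSeries.coeff_add, HahnSeries.coeff_sub, HahnSeries.coeff_neg,
    coeff_cst_mul,
    coeff_zetaNeg_mul, coeff_zetaNeg_inv_mul] <;>
  grind

theorem IsNegFactor.rightOne (h : IsNegFactor M) (u q : ℂ) :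
    IsNegFactor (GR1 u q * M) := by
  obtain ⟨hd, hdi, hu, hl⟩ := h
  obtain ⟨h0, h0'⟩ := hdi 0
  obtain ⟨h1, h1'⟩ := hdi 1
  refine ⟨by simp [Matrix.det_mul, hd, det_GR1],
    Fin.forall_fin_two.2 ⟨⟨?_, fun n hn => ?_⟩, ?_, fun n hn => ?_⟩,
    fun n hn => ?_, fun n hn => ?_⟩ <;>
  simp only [GR1_mul,
    Matrix.of_apply, Matrix.cons_val', Matrix.cons_val_zero, Matrix.cons_val_one,
    Matrix.cons_val_fin_one, HahnSeries.coeff_add, HahnSeries.coeff_sub, HahnSeries.coeff_neg,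
    coeff_cst_mul,
    coeff_zetaNeg_mul, coeff_zetaNeg_inv_mul] <;>
  grind

/-- Conjugation by P swaps the diagonal entries and exchanges the off-diagonal ones with a shift by
one power of ζ, which is precisely the offset between the bounds in `upper` and `lower`. -/
theorem IsNegFactor.dynkin (h : IsNegFactor M) :
    IsNegFactor ((Pmat zetaNeg)⁻¹ * M * Pmat zetaNeg) := by
  obtain ⟨hd, hdi, hu, hl⟩ := h
  obtain ⟨h0, h0'⟩ := hdi 0
  obtain ⟨h1, h1'⟩ := hdi 1
  refine ⟨by simp [Matrix.det_mul, hd, Matrix.det_nonsing_inv, det_Pmat, zetaNeg_ne_zero],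
    Fin.forall_fin_two.2 ⟨⟨?_, fun n hn => ?_⟩, ?_, fun n hn => ?_⟩,
    fun n hn => ?_, fun n hn => ?_⟩ <;>
  simp only [Pmat_conj zetaNeg_ne_zero,
    Matrix.of_apply, Matrix.cons_val', Matrix.cons_val_zero, Matrix.cons_val_one,
    Matrix.cons_val_fin_one, HahnSeries.coeff_add, HahnSeries.coeff_sub, HahnSeries.coeff_neg,
    coeff_cst_mul,
    coeff_zetaNeg_mul, coeff_zetaNeg_inv_mul] <;>
  grind

theorem IsPosFactor.dynkin (h : IsPosFactor M) :
    IsPosFactor ((Pmat zetaPos)⁻¹ * M * Pmat zetaPos) := by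
  obtain ⟨hd, hdi, hu, hl⟩ := h
  obtain ⟨h0, h0'⟩ := hdi 0
  obtain ⟨h1, h1'⟩ := hdi 1
  refine ⟨by simp [Matrix.det_mul, hd, Matrix.det_nonsing_inv, det_Pmat, zetaPos_ne_zero],
    Fin.forall_fin_two.2 ⟨⟨?_, fun n hn => ?_⟩, ?_, fun n hn => ?_⟩,
    fun n hn => ?_, fun n hn => ?_⟩ <;>
  simp only [Pmat_conj zetaPos_ne_zero,
    Matrix.of_apply, Matrix.cons_val', Matrix.cons_val_zero, Matrix.cons_val_one,
    Matrix.cons_val_fin_one, HahnSeries.coeff_add, HahnSeries.coeff_sub, HahnSeries.coeff_neg,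
    coeff_cst_mul,
    coeff_zetaPos_mul, coeff_zetaPos_inv_mul] <;>
  grind

end factors

/-! ### The effect on the diagonal factor g₀ -/

/-- The diagonal matrix `diag(e, e⁻¹)` of constants. -/
def diagInv (e : ℂ) : Mat := !![cst e, 0; 0, cst e⁻¹]

theorem powH_eq (s a : ℂ) : powH s a = diagInv (Complex.exp (s * a)) := by
  rw [powH, diagInv, Complex.exp_neg]

theorem powH_neg (s a : ℂ) : powH s (-a) = diagInv (Complex.exp (s * a))⁻¹ := by
  rw [powH_eq, mul_neg, Complex.exp_neg]

theorem mul_inv_eq_of_eq_mul {A B D : Mat} (hB : B.det = 1) (h : A = D * B) : A * B⁻¹ = D := by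
  rw [h, Matrix.mul_assoc, Matrix.mul_nonsing_inv _ (by simp [hB]), Matrix.mul_one]

/-- Multiplying by G on the left creates an off-diagonal entry ζu, and Ḡ is the unipotent matrix
that removes it on the right. -/
theorem leftZero_diagInv (z : LaurentSeries ℂ) {u q : ℂ} (hu : u ≠ 0) (hq : q ≠ 0) :
    GL0 z q * diagInv u * (GbarL0 z u q)⁻¹ = diagInv (-u / q) := by
  have hu' := cst_ne_zero hu
  have hq' := cst_ne_zero hq
  refine mul_inv_eq_of_eq_mul (det_GbarL0 ..) ?_
  rw [GL0, GbarL0, diagInv, diagInv, Matrix.mul_fin_two, Matrix.mul_fin_two]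
  simp only [map_div₀, map_neg, map_inv₀, map_pow, map_one]
  refine mat_ext ?_ ?_ ?_ ?_ <;> field_simp <;> ring

theorem leftOne_diagInv {u r : ℂ} (hu : u ≠ 0) (hr : r ≠ 0) :
    GL1 r * diagInv u * (GbarL1 u r)⁻¹ = diagInv (-(r * u)) := by
  have hu' := cst_ne_zero hu
  have hr' := cst_ne_zero hr
  refine mul_inv_eq_of_eq_mul (det_GbarL1 ..) ?_
  rw [GL1, GbarL1, diagInv, diagInv, Matrix.mul_fin_two, Matrix.mul_fin_two]
  simp only [map_mul, map_div₀, map_neg, map_inv₀, map_pow, map_one]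
  refine mat_ext ?_ ?_ ?_ ?_ <;> field_simp <;> ring

theorem rightZero_diagInv {z : LaurentSeries ℂ} (hz : z ≠ 0) {u r : ℂ} (hu : u ≠ 0) (hr : r ≠ 0) :
    GR0 z u r * diagInv u * (GbarR0 z r)⁻¹ = diagInv (u / r) := by
  have hu' := cst_ne_zero hu
  have hr' := cst_ne_zero hr
  refine mul_inv_eq_of_eq_mul (det_GbarR0 _ hr) ?_
  rw [GR0, GbarR0, diagInv, diagInv, Matrix.mul_fin_two, Matrix.mul_fin_two]
  simp only [map_div₀, map_inv₀, map_pow, map_one]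
  refine mat_ext ?_ ?_ ?_ ?_ <;> field_simp <;> ring

theorem rightOne_diagInv {u q : ℂ} (hu : u ≠ 0) (hq : q ≠ 0) :
    GR1 u q * diagInv u * (GbarR1 q)⁻¹ = diagInv (q * u) := by
  have hu' := cst_ne_zero hu
  have hq' := cst_ne_zero hq
  refine mul_inv_eq_of_eq_mul (det_GbarR1 hq) ?_
  rw [GR1, GbarR1, diagInv, diagInv, Matrix.mul_fin_two, Matrix.mul_fin_two]
  simp only [map_mul, map_div₀, map_neg, map_inv₀, map_pow, map_one]
  refine mat_ext ?_ ?_ ?_ ?_ <;> field_simp <;> ring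

theorem dynkin_diagInv {z : LaurentSeries ℂ} (hz : z ≠ 0) (u : ℂ) :
    (Pmat z)⁻¹ * diagInv u * Pmat z = diagInv u⁻¹ := by
  rw [Pmat_conj hz]
  simp [diagInv]

/-! ### Homogeneity of matrices under rescaling -/

/-- `M` is obtained from `M'` by applying `ρ` to the entries and conjugating by a constant
diagonal matrix with ratio `w` of its entries. -/
structure Intertwined (ρ : LaurentSeries ℂ →+* LaurentSeries ℂ) (w : ℂ) (M M' : Mat) : Prop where
  e00 : M 0 0 = ρ (M' 0 0)
  e01 : M 0 1 = cst w * ρ (M' 0 1)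
  e10 : M 1 0 = cst w⁻¹ * ρ (M' 1 0)
  e11 : M 1 1 = ρ (M' 1 1)

/-- Conjugation by diag(e, e⁻¹) depends on e² alone. Working with the square spares any choice of a
root of λ when π shifts the parameters by 1/2. -/
theorem intertwined_iff {ρ : LaurentSeries ℂ →+* LaurentSeries ℂ} {e : ℂ} (he : e ≠ 0)
    {M M' : Mat} :
    Intertwined ρ (e ^ 2) M M' ↔ M = diagInv e * M'.map ρ * diagInv e⁻¹ := by
  have he' := cst_ne_zero he
  have h : diagInv e * M'.map ρ * diagInv e⁻¹ = !![ρ (M' 0 0), cst (e ^ 2) * ρ (M' 0 1);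
      cst (e ^ 2)⁻¹ * ρ (M' 1 0), ρ (M' 1 1)] := by
    rw [Matrix.eta_fin_two (M'.map ρ), diagInv, diagInv, Matrix.mul_fin_two, Matrix.mul_fin_two]
    simp only [map_inv₀, map_pow, Matrix.map_apply]
    refine mat_ext ?_ ?_ ?_ ?_ <;> field_simp <;> ring
  rw [h]
  constructor
  · rintro ⟨h0, h1, h2, h3⟩
    rw [Matrix.eta_fin_two M, h0, h1, h2, h3]
  · rintro rfl
    exact ⟨rfl, rfl, rfl, rfl⟩

section intertwined

variable {ρ : LaurentSeries ℂ →+* LaurentSeries ℂ} {z : LaurentSeries ℂ} {w l : ℂ} {M M' : Mat}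

/-- The new upper right entry is -(ζq)⁻¹ times the old upper left one: q contributes (wl)⁻¹ and ζ
contributes l⁻¹. For w = λ^{2α}, l = λ, the new weight is λ^{2(-α-1)}. -/
theorem Intertwined.leftZero (h : Intertwined ρ w M M') (hρ : ∀ a, ρ (cst a) = cst a)
    (hz : ρ z = cst l⁻¹ * z) (hz0 : z ≠ 0) (hw : w ≠ 0) (hl : l ≠ 0) {q q' : ℂ} (hq0 : q ≠ 0)
    (hq : q = w * l * q') :
    Intertwined ρ (w * l ^ 2)⁻¹ (GL0 z q * M * S0 z) (GL0 z q' * M' * S0 z) := by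
  have hq'0 : q' ≠ 0 := by grind
  have h1 := cst_ne_zero hw
  have h2 := cst_ne_zero hl
  have h3 := cst_ne_zero hq'0
  rw [leftZero_mul z hz0, leftZero_mul z hz0]
  obtain ⟨e0, e1, e2, e3⟩ := h
  constructor <;>
  simp only [Matrix.of_apply, Matrix.cons_val', Matrix.cons_val_zero, Matrix.cons_val_one,
    Matrix.cons_val_fin_one, e0, e1, e2, e3, hq, map_add, map_sub, map_neg, map_mul, map_inv₀, hρ,
    hz, map_div₀, map_pow, map_one] <;>
  field_simp

theorem Intertwined.leftOne (h : Intertwined ρ w M M') (hρ : ∀ a, ρ (cst a) = cst a)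
    (hw : w ≠ 0) {r r' : ℂ} (hr0 : r ≠ 0) (hr : r = w⁻¹ * r') :
    Intertwined ρ w⁻¹ (GL1 r * M * S1) (GL1 r' * M' * S1) := by
  have hr'0 : r' ≠ 0 := by grind
  have h1 := cst_ne_zero hw
  have h3 := cst_ne_zero hr'0
  rw [leftOne_mul, leftOne_mul]
  obtain ⟨e0, e1, e2, e3⟩ := h
  constructor <;>
  simp only [Matrix.of_apply, Matrix.cons_val', Matrix.cons_val_zero, Matrix.cons_val_one,
    Matrix.cons_val_fin_one, e0, e1, e2, e3, hr, map_add, map_sub, map_neg, map_mul, map_inv₀, hρ,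
    map_div₀, map_one] <;>
  field_simp

theorem Intertwined.rightZero (h : Intertwined ρ w M M') (hρ : ∀ a, ρ (cst a) = cst a)
    (hz : ρ z = cst l⁻¹ * z) (hz0 : z ≠ 0) (hw : w ≠ 0) (hl : l ≠ 0) {r r' : ℂ} (hr0 : r ≠ 0)
    (hr : r = (w * l)⁻¹ * r') :
    Intertwined ρ (w * l ^ 2)⁻¹ (GbarR0 z r * M * S0 z) (GbarR0 z r' * M' * S0 z) := by
  have hr'0 : r' ≠ 0 := by grind
  have h1 := cst_ne_zero hw
  have h2 := cst_ne_zero hl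
  have h3 := cst_ne_zero hr'0
  rw [rightZero_mul z hz0, rightZero_mul z hz0]
  obtain ⟨e0, e1, e2, e3⟩ := h
  constructor <;>
  simp only [Matrix.of_apply, Matrix.cons_val', Matrix.cons_val_zero, Matrix.cons_val_one,
    Matrix.cons_val_fin_one, e0, e1, e2, e3, hr, map_sub, map_neg, map_mul, map_inv₀, hρ,
    hz, map_div₀, map_pow, map_one] <;>
  field_simp

theorem Intertwined.rightOne (h : Intertwined ρ w M M') (hρ : ∀ a, ρ (cst a) = cst a)
    (hw : w ≠ 0) {q q' : ℂ} (hq0 : q ≠ 0) (hq : q = w * q') :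
    Intertwined ρ w⁻¹ (GbarR1 q * M * S1) (GbarR1 q' * M' * S1) := by
  have hq'0 : q' ≠ 0 := by grind
  have h1 := cst_ne_zero hw
  have h3 := cst_ne_zero hq'0
  rw [rightOne_mul, rightOne_mul]
  obtain ⟨e0, e1, e2, e3⟩ := h
  constructor <;>
  simp only [Matrix.of_apply, Matrix.cons_val', Matrix.cons_val_zero, Matrix.cons_val_one,
    Matrix.cons_val_fin_one, e0, e1, e2, e3, hq, map_sub, map_neg, map_mul, map_inv₀, hρ,
    map_div₀, map_one] <;>
  field_simp

/-- Applied to g_{>0}, so w plays the role of λ^{2β}. The condition makes the entry of Ḡ as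
homogeneous as a lower left entry of M, so the weight is kept. -/
theorem Intertwined.GbarL0_mul (h : Intertwined ρ w M M') (hρ : ∀ a, ρ (cst a) = cst a)
    (hz : ρ z = cst l⁻¹ * z) (hw : w ≠ 0) (hl : l ≠ 0) {u u' q q' : ℂ}
    (hq : u ^ 2 / q = (w * l)⁻¹ * (u' ^ 2 / q')) :
    Intertwined ρ w (GbarL0 z u q * M) (GbarL0 z u' q' * M') := by
  have h1 := cst_ne_zero hw
  have h2 := cst_ne_zero hl
  rw [MPLR.GbarL0_mul, MPLR.GbarL0_mul, hq]
  obtain ⟨e0, e1, e2, e3⟩ := h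
  constructor <;>
  simp only [Matrix.of_apply, Matrix.cons_val', Matrix.cons_val_zero, Matrix.cons_val_one,
    Matrix.cons_val_fin_one, e0, e1, e2, e3, map_sub, map_mul _ w, map_mul ρ,
    map_mul _ _ (u' ^ 2 / q'), map_inv₀, hρ, hz] <;>
  field_simp

theorem Intertwined.GbarL1_mul (h : Intertwined ρ w M M') (hρ : ∀ a, ρ (cst a) = cst a)
    (hw : w ≠ 0) {u u' r r' : ℂ} (hr : -1 / (r * u ^ 2) = w * (-1 / (r' * u' ^ 2))) :
    Intertwined ρ w (GbarL1 u r * M) (GbarL1 u' r' * M') := by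
  have h1 := cst_ne_zero hw
  rw [MPLR.GbarL1_mul, MPLR.GbarL1_mul, hr]
  obtain ⟨e0, e1, e2, e3⟩ := h
  constructor <;>
  simp only [Matrix.of_apply, Matrix.cons_val', Matrix.cons_val_zero, Matrix.cons_val_one,
    Matrix.cons_val_fin_one, e0, e1, e2, e3, map_add, map_mul _ w, map_mul ρ, map_inv₀, hρ] <;>
  field_simp

theorem Intertwined.GR0_mul (h : Intertwined ρ w M M') (hρ : ∀ a, ρ (cst a) = cst a)
    (hz : ρ z = cst l⁻¹ * z) (hz0 : z ≠ 0) (hw : w ≠ 0) (hl : l ≠ 0) {u u' r r' : ℂ}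
    (hr : u ^ 2 / r = w * l * (u' ^ 2 / r')) :
    Intertwined ρ w (GR0 z u r * M) (GR0 z u' r' * M') := by
  have h1 := cst_ne_zero hw
  have h2 := cst_ne_zero hl
  rw [MPLR.GR0_mul, MPLR.GR0_mul, hr]
  obtain ⟨e0, e1, e2, e3⟩ := h
  constructor <;>
  simp only [Matrix.of_apply, Matrix.cons_val', Matrix.cons_val_zero, Matrix.cons_val_one,
    Matrix.cons_val_fin_one, e0, e1, e2, e3, map_sub, map_mul _ w, map_mul ρ,
    map_mul _ _ (u' ^ 2 / r'), map_inv₀, hρ, hz] <;>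
  field_simp

theorem Intertwined.GR1_mul (h : Intertwined ρ w M M') (hρ : ∀ a, ρ (cst a) = cst a)
    (hw : w ≠ 0) {u u' q q' : ℂ} (hq : -1 / (q * u ^ 2) = w⁻¹ * (-1 / (q' * u' ^ 2))) :
    Intertwined ρ w (GR1 u q * M) (GR1 u' q' * M') := by
  have h1 := cst_ne_zero hw
  rw [MPLR.GR1_mul, MPLR.GR1_mul, hq]
  obtain ⟨e0, e1, e2, e3⟩ := h
  constructor <;>
  simp only [Matrix.of_apply, Matrix.cons_val', Matrix.cons_val_zero, Matrix.cons_val_one,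
    Matrix.cons_val_fin_one, e0, e1, e2, e3, map_add, map_mul _ w⁻¹, map_mul ρ, map_inv₀, hρ] <;>
  field_simp

/-- The new upper right entry is -ζ⁻¹ times the old lower left one, of weight l⁻¹w⁻¹. -/
theorem Intertwined.dynkin (h : Intertwined ρ w M M')
    (hz : ρ z = cst l⁻¹ * z) (hz0 : z ≠ 0) (hw : w ≠ 0) (hl : l ≠ 0) :
    Intertwined ρ (w * l)⁻¹ ((Pmat z)⁻¹ * M * Pmat z) ((Pmat z)⁻¹ * M' * Pmat z) := by
  have h1 := cst_ne_zero hw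
  have h2 := cst_ne_zero hl
  rw [Pmat_conj hz0, Pmat_conj hz0]
  obtain ⟨e0, e1, e2, e3⟩ := h
  constructor <;>
  simp only [Matrix.of_apply, Matrix.cons_val', Matrix.cons_val_zero, Matrix.cons_val_one,
    Matrix.cons_val_fin_one, e0, e1, e2, e3, map_neg, map_mul, map_inv₀, hz] <;>
  field_simp

end intertwined

/-! ### Scaling orbits and admissible data -/

theorem scale_flipL (c : ℂ) (p : Times) : scale c (flipL p) = flipL (scale c p) := by
  ext n <;> simp [scale, flipL]

theorem scale_flipR (c : ℂ) (p : Times) : scale c (flipR p) = flipR (scale c p) := by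
  ext n <;> simp [scale, flipR]

theorem scale_neg (c : ℂ) (p : Times) : scale c (-p) = -scale c p := by
  ext n <;> simp [scale]

/-- The exponent is the derivative of e^{sa} at s = 0. -/
theorem eq_of_eventually_exp_eq {a b : ℂ}
    (h : ∀ᶠ s in nhds (0 : ℂ), Complex.exp (s * a) = Complex.exp (s * b)) : a = b := by
  have hd : ∀ c : ℂ, HasDerivAt (fun s : ℂ => Complex.exp (s * c)) c 0 := fun c => by
    simpa using ((hasDerivAt_id (0 : ℂ)).mul_const c).cexp
  exact (hd a).unique ((hd b).congr_of_eventuallyEq h)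

namespace Data

variable {g : Data} {α β : ℂ} {p p' : Times}

/-- The scaling path from `p` to `scale (exp s) p` stays in the domain. -/
def HasPath (g : Data) (p : Times) (s : ℂ) : Prop :=
  ∀ σ ∈ Set.Icc (0 : ℝ) 1, scale (Complex.exp (σ * s)) p ∈ g.dom

theorem HasPath.mem_dom {s : ℂ} (h : g.HasPath p s) : scale (Complex.exp s) p ∈ g.dom := by
  simpa using h 1 (by simp)

/-- A ball around 0 is star-shaped, so with s it contains all σs, 0 ≤ σ ≤ 1. -/
theorem ScaleOpen.eventually_hasPath (h : g.ScaleOpen) (hp : p ∈ g.dom) :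
    ∀ᶠ s in nhds (0 : ℂ), g.HasPath p s := by
  obtain ⟨ε, hε, hb⟩ := Metric.eventually_nhds_iff.1 (h p hp)
  refine Metric.eventually_nhds_iff.2 ⟨ε, hε, fun s hs σ hσ => hb ?_⟩
  rw [dist_zero_right] at hs ⊢
  rw [norm_mul, Complex.norm_real, Real.norm_of_nonneg hσ.1]
  exact (mul_le_of_le_one_left (norm_nonneg _) hσ.2).trans_lt hs

/-- The relations between the dependent variables at `p` and `p'` imposed by the similarity
conditions, with `l`, `w`, `v`, `y` in the roles of `λ`, `λ^{2α}`, `λ^{2β}`, `λ^{α-β}`. -/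
structure Related (g : Data) (l : ℂ) (hl : l ≠ 0) (w v y : ℂ) (p p' : Times) : Prop where
  neg : Intertwined (rescaleHom l hl) w (g.gneg p) (g.gneg p')
  pos : Intertwined (rescaleHom l⁻¹ (inv_ne_zero hl)) v (g.gpos p) (g.gpos p')
  zero : g.ephi p = y * g.ephi p'

/-- Data of Gauss form on a domain open along the scaling, similar with parameters `(α, β)`. -/
structure Admissible (g : Data) (α β : ℂ) : Prop where
  neg : ∀ p ∈ g.dom, IsNegFactor (g.gneg p)
  pos : ∀ p ∈ g.dom, IsPosFactor (g.gpos p)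
  ephi_ne : ∀ p ∈ g.dom, g.ephi p ≠ 0
  zero : ∀ p ∈ g.dom, g.gzero p = diagInv (g.ephi p)
  isOpen : g.ScaleOpen
  related : ∀ p ∈ g.dom, ∀ s, g.HasPath p s →
    g.Related (Complex.exp s) (Complex.exp_ne_zero s) (Complex.exp (s * α) ^ 2)
      (Complex.exp (s * β) ^ 2) (Complex.exp (s * α) / Complex.exp (s * β)) p
      (scale (Complex.exp s) p)

theorem ephi_eq {u : ℂ} (h : g.gzero p = diagInv u) : g.ephi p = u := by
  simp [ephi, h, diagInv]

theorem isGauss_iff : g.IsGauss ↔ (∀ p ∈ g.dom, IsNegFactor (g.gneg p)) ∧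
    (∀ p ∈ g.dom, IsPosFactor (g.gpos p)) ∧ (∀ p ∈ g.dom, g.ephi p ≠ 0) ∧
    ∀ p ∈ g.dom, g.gzero p = diagInv (g.ephi p) := by
  constructor
  · intro h
    refine ⟨fun p hp => ⟨h.neg_det p hp, h.neg_diag p hp, h.neg_upper p hp, h.neg_lower p hp⟩,
      fun p hp => ⟨h.pos_det p hp, h.pos_diag p hp, h.pos_upper p hp, h.pos_lower p hp⟩,
      fun p hp => ?_, fun p hp => ?_⟩ <;>
    obtain ⟨u, hu, hz⟩ := h.zero_form p hp
    · rwa [ephi_eq hz]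
    · rw [ephi_eq hz, hz, diagInv]
  · rintro ⟨hn, hp, he, hz⟩
    exact ⟨fun p h => (hn p h).det, fun p h => (hn p h).diag, fun p h => (hn p h).upper,
      fun p h => (hn p h).lower, fun p h => ⟨_, he p h, hz p h⟩, fun p h => (hp p h).det,
      fun p h => (hp p h).diag, fun p h => (hp p h).upper, fun p h => (hp p h).lower⟩

theorem diagInv_eq_mul_iff {e f u u' : ℂ} :
    diagInv u = diagInv e * diagInv u' * diagInv f⁻¹ ↔ u = e / f * u' := by
  have h : diagInv e * diagInv u' * diagInv f⁻¹ = diagInv (e / f * u') := by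
    simp only [diagInv, Matrix.mul_fin_two, inv_inv]
    refine mat_ext ?_ ?_ ?_ ?_ <;>
    simp only [map_mul, map_inv₀, map_div₀, mul_zero, zero_mul, add_zero, zero_add, mul_inv,
      inv_div] <;> ring
  rw [h]
  refine ⟨fun hd => ?_, fun hu => by rw [hu]⟩
  simpa [diagInv] using congrArg (fun M : Mat => (M 0 0).coeff 0) hd

theorem admissible_iff :
    g.Admissible α β ↔ g.IsGauss ∧ g.ScaleOpen ∧ g.Similar α β := by
  -- Once g₀ is known to be diagonal of determinant 1, the equivalence holds separately for each
  -- time and each s.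
  have key : ∀ (hz : ∀ p ∈ g.dom, g.gzero p = diagInv (g.ephi p)) (p) (_ : p ∈ g.dom) (s)
      (_ : g.HasPath p s), g.Related (Complex.exp s) (Complex.exp_ne_zero s)
        (Complex.exp (s * α) ^ 2) (Complex.exp (s * β) ^ 2)
        (Complex.exp (s * α) / Complex.exp (s * β)) p (scale (Complex.exp s) p) ↔
      g.gneg p = powH s α
          * (g.gneg (scale (Complex.exp s) p)).map (rescale (Complex.exp s)) * powH s (-α) ∧
      g.gzero p = powH s α * g.gzero (scale (Complex.exp s) p) * powH s (-β) ∧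
      g.gpos p = powH s β
          * (g.gpos (scale (Complex.exp s) p)).map (rescale (Complex.exp (-s))) * powH s (-β) := by
    intro hz p hp s hs
    rw [hz p hp, hz _ hs.mem_dom, powH_neg, powH_neg, powH_eq, powH_eq, diagInv_eq_mul_iff,
      Complex.exp_neg]
    have e1 := intertwined_iff (ρ := rescaleHom (Complex.exp s) (Complex.exp_ne_zero s))
      (Complex.exp_ne_zero (s * α)) (M := g.gneg p) (M' := g.gneg (scale (Complex.exp s) p))
    have e2 := intertwined_iff (ρ := rescaleHom (Complex.exp s)⁻¹
      (inv_ne_zero (Complex.exp_ne_zero s)))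
      (Complex.exp_ne_zero (s * β)) (M := g.gpos p) (M' := g.gpos (scale (Complex.exp s) p))
    exact ⟨fun h => ⟨e1.1 h.neg, h.zero, e2.1 h.pos⟩, fun h => ⟨e1.2 h.1, e2.2 h.2.2, h.2.1⟩⟩
  rw [isGauss_iff]
  constructor
  · rintro ⟨hn, hp, he, hz, ho, hr⟩
    exact ⟨⟨hn, hp, he, hz⟩, ho, fun p hp s hs => (key hz p hp s hs).1 (hr p hp s hs)⟩
  · rintro ⟨⟨hn, hp, he, hz⟩, ho, hs⟩
    exact ⟨hn, hp, he, hz, ho, fun p hp s h => (key hz p hp s h).2 (hs p hp s h)⟩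

section related

variable {l w v y : ℂ} {hl : l ≠ 0}

theorem Related.q_eq (h : g.Related l hl w v y p p') : g.q p = w * l * g.q p' := by
  rw [q, h.neg.e01, coeff_cst_mul, coeff_rescaleHom, zpow_one, mul_assoc, q]

theorem Related.r_eq (h : g.Related l hl w v y p p') : g.r p = w⁻¹ * g.r p' := by
  rw [r, h.neg.e10, coeff_cst_mul, coeff_rescaleHom, zpow_zero, one_mul, r]

theorem Related.qbar_eq (h : g.Related l hl w v y p p') : g.qbar p = v * g.qbar p' := by
  rw [qbar, h.pos.e01, coeff_cst_mul, coeff_rescaleHom, zpow_zero, one_mul, qbar]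

theorem Related.rbar_eq (h : g.Related l hl w v y p p') :
    g.rbar p = (v * l)⁻¹ * g.rbar p' := by
  rw [rbar, h.pos.e10, coeff_cst_mul, coeff_rescaleHom, zpow_one, mul_inv, mul_assoc, rbar]

end related

theorem rescaleHom_cst (c : ℂ) (hc : c ≠ 0) (a : ℂ) : rescaleHom c hc (cst a) = cst a := by
  simp [HahnSeries.C_apply]

/-- The series variable is ζ⁻¹ here and ζ in the next lemma, rescaled by λ and λ⁻¹ respectively.
Both times ζ becomes λ⁻¹ζ, so the intertwining lemmas can be stated for a general z. -/
theorem rescaleHom_zetaNeg (l : ℂ) (hl : l ≠ 0) :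
    rescaleHom l hl zetaNeg = cst l⁻¹ * zetaNeg := by
  rw [zetaNeg, rescaleHom_single, ← zpow_neg_one]
  simp [cst, HahnSeries.C_apply, -map_zpow₀, -map_inv₀]

theorem rescaleHom_zetaPos (l : ℂ) (hl : l ≠ 0) :
    rescaleHom l⁻¹ (inv_ne_zero hl) zetaPos = cst l⁻¹ * zetaPos := by
  rw [zetaPos, rescaleHom_single]
  simp [cst, HahnSeries.C_apply, -map_inv₀]

/-! ### The generators act on the parameters by reflections -/

theorem ScaleOpen.restrict {g g' : Data} (ho : g.ScaleOpen) {ι : Times → Times}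
    (hι : ∀ c p, scale c (ι p) = ι (scale c p)) {x : Times → ℂ}
    (hdom : g'.dom = {p | ι p ∈ g.dom ∧ x (ι p) ≠ 0})
    (hx : ∀ p ∈ g.dom, ∀ s, g.HasPath p s → x p ≠ 0 → x (scale (Complex.exp s) p) ≠ 0) :
    g'.ScaleOpen := by
  intro p hp
  rw [hdom] at hp ⊢
  filter_upwards [ho.eventually_hasPath hp.1] with s hs
  refine ⟨?_, ?_⟩
  · simpa [hι] using hs.mem_dom
  · simpa [hι] using hx _ hp.1 s hs hp.2

theorem HasPath.of_restrict {g g' : Data} {s : ℂ} (h : g'.HasPath p s)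
    {ι : Times → Times} (hι : ∀ c p, scale c (ι p) = ι (scale c p))
    (hdom : ∀ p ∈ g'.dom, ι p ∈ g.dom) : g.HasPath (ι p) s := fun σ hσ => by
  rw [hι]
  exact hdom _ (h σ hσ)

theorem Admissible.sL0 (h : g.Admissible α β) : (MPLR.sL0 g).Admissible (-α - 1) β := by
  have hz : ∀ p ∈ (MPLR.sL0 g).dom, (MPLR.sL0 g).gzero p = diagInv (-g.ephi (flipL p) / g.q (flipL p)) :=
      fun p hp => by
    simp only [MPLR.sL0]
    rw [h.zero _ hp.1, leftZero_diagInv _ (h.ephi_ne _ hp.1) hp.2]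
  refine ⟨fun p hp => (h.neg _ hp.1).leftZero hp.2, fun p hp => (h.pos _ hp.1).leftZero _ _,
    fun p hp => ?_, fun p hp => ?_, h.isOpen.restrict scale_flipL rfl fun p hp s hs hx => ?_,
    fun p hp s hs => ?_⟩
  · rw [ephi_eq (hz p hp)]
    exact div_ne_zero (neg_ne_zero.2 (h.ephi_ne _ hp.1)) hp.2
  · rw [ephi_eq (hz p hp), hz p hp]
  -- Along a scaling path q only changes by a nonzero factor, so the path never enters the removed
  -- locus q = 0.
  · rw [(h.related p hp s hs).q_eq] at hx
    exact right_ne_zero_of_mul hx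
  · have hr := h.related _ hp.1 s (hs.of_restrict scale_flipL fun p hp => hp.1)
    rw [scale_flipL] at hr
    have hs' := hs.mem_dom
    have hl := Complex.exp_ne_zero s
    have ha := Complex.exp_ne_zero (s * α)
    have hb := Complex.exp_ne_zero (s * β)
    have hw : Complex.exp (s * (-α - 1)) = (Complex.exp (s * α) * Complex.exp s)⁻¹ := by
      rw [← Complex.exp_add, ← Complex.exp_neg]
      ring_nf
    rw [hw]
    refine ⟨?_, ?_, ?_⟩
    · rw [inv_pow, mul_pow]
      exact hr.neg.leftZero (rescaleHom_cst _ _) (rescaleHom_zetaNeg _ hl) zetaNeg_ne_zero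
        (pow_ne_zero 2 ha) hl hp.2 hr.q_eq
    · refine hr.pos.GbarL0_mul (rescaleHom_cst _ _) (rescaleHom_zetaPos _ hl) (pow_ne_zero 2 hb)
        hl ?_
      -- The weight of e^{2φ}/q is λ^{2(α-β)-(2α+1)} = λ^{-2β-1}: the dependence on α drops out.
      rw [hr.q_eq, hr.zero]
      field_simp
    · rw [ephi_eq (hz p hp), ephi_eq (hz _ hs'), hr.q_eq, hr.zero]
      field_simp

theorem Admissible.sL1 (h : g.Admissible α β) : (MPLR.sL1 g).Admissible (-α) β := by
  have hz : ∀ p ∈ (MPLR.sL1 g).dom, (MPLR.sL1 g).gzero p = diagInv (-(g.r (flipL p) * g.ephi (flipL p))) :=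
      fun p hp => by
    simp only [MPLR.sL1]
    rw [h.zero _ hp.1, leftOne_diagInv (h.ephi_ne _ hp.1) hp.2]
  refine ⟨fun p hp => (h.neg _ hp.1).leftOne hp.2, fun p hp => (h.pos _ hp.1).leftOne _ _,
    fun p hp => ?_, fun p hp => ?_, h.isOpen.restrict scale_flipL rfl fun p hp s hs hx => ?_,
    fun p hp s hs => ?_⟩
  · rw [ephi_eq (hz p hp)]
    exact neg_ne_zero.2 (mul_ne_zero hp.2 (h.ephi_ne _ hp.1))
  · rw [ephi_eq (hz p hp), hz p hp]
  · rw [(h.related p hp s hs).r_eq] at hx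
    exact right_ne_zero_of_mul hx
  · have hr := h.related _ hp.1 s (hs.of_restrict scale_flipL fun p hp => hp.1)
    rw [scale_flipL] at hr
    have hs' := hs.mem_dom
    have hl := Complex.exp_ne_zero s
    have ha := Complex.exp_ne_zero (s * α)
    have hb := Complex.exp_ne_zero (s * β)
    rw [mul_neg, Complex.exp_neg]
    refine ⟨?_, ?_, ?_⟩
    · rw [inv_pow]
      exact hr.neg.leftOne (rescaleHom_cst _ _) (pow_ne_zero 2 ha) hp.2 hr.r_eq
    · refine hr.pos.GbarL1_mul (rescaleHom_cst _ _) (pow_ne_zero 2 hb) ?_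
      rw [hr.r_eq, hr.zero]
      field_simp
    · rw [ephi_eq (hz p hp), ephi_eq (hz _ hs'), hr.r_eq, hr.zero]
      field_simp

theorem Admissible.sR0 (h : g.Admissible α β) : (MPLR.sR0 g).Admissible α (-β - 1) := by
  have hz : ∀ p ∈ (MPLR.sR0 g).dom, (MPLR.sR0 g).gzero p = diagInv (g.ephi (flipR p) / g.rbar (flipR p)) :=
      fun p hp => by
    simp only [MPLR.sR0]
    rw [h.zero _ hp.1, rightZero_diagInv zetaPos_ne_zero (h.ephi_ne _ hp.1) hp.2]
  refine ⟨fun p hp => (h.neg _ hp.1).rightZero _ _, fun p hp => (h.pos _ hp.1).rightZero hp.2,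
    fun p hp => ?_, fun p hp => ?_, h.isOpen.restrict scale_flipR rfl fun p hp s hs hx => ?_,
    fun p hp s hs => ?_⟩
  · rw [ephi_eq (hz p hp)]
    exact div_ne_zero (h.ephi_ne _ hp.1) hp.2
  · rw [ephi_eq (hz p hp), hz p hp]
  · rw [(h.related p hp s hs).rbar_eq] at hx
    exact right_ne_zero_of_mul hx
  · have hr := h.related _ hp.1 s (hs.of_restrict scale_flipR fun p hp => hp.1)
    rw [scale_flipR] at hr
    have hs' := hs.mem_dom
    have hl := Complex.exp_ne_zero s
    have ha := Complex.exp_ne_zero (s * α)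
    have hb := Complex.exp_ne_zero (s * β)
    have hw : Complex.exp (s * (-β - 1)) = (Complex.exp (s * β) * Complex.exp s)⁻¹ := by
      rw [← Complex.exp_add, ← Complex.exp_neg]
      ring_nf
    rw [hw]
    refine ⟨?_, ?_, ?_⟩
    · refine hr.neg.GR0_mul (rescaleHom_cst _ _) (rescaleHom_zetaNeg _ hl) zetaNeg_ne_zero
        (pow_ne_zero 2 ha) hl ?_
      rw [hr.rbar_eq, hr.zero]
      field_simp
    · rw [inv_pow, mul_pow]
      exact hr.pos.rightZero (rescaleHom_cst _ _) (rescaleHom_zetaPos _ hl) zetaPos_ne_zero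
        (pow_ne_zero 2 hb) hl hp.2 hr.rbar_eq
    · rw [ephi_eq (hz p hp), ephi_eq (hz _ hs'), hr.rbar_eq, hr.zero]
      field_simp

theorem Admissible.sR1 (h : g.Admissible α β) : (MPLR.sR1 g).Admissible α (-β) := by
  have hz : ∀ p ∈ (MPLR.sR1 g).dom, (MPLR.sR1 g).gzero p = diagInv (g.qbar (flipR p) * g.ephi (flipR p)) :=
      fun p hp => by
    simp only [MPLR.sR1]
    rw [h.zero _ hp.1, rightOne_diagInv (h.ephi_ne _ hp.1) hp.2]
  refine ⟨fun p hp => (h.neg _ hp.1).rightOne _ _, fun p hp => (h.pos _ hp.1).rightOne hp.2,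
    fun p hp => ?_, fun p hp => ?_, h.isOpen.restrict scale_flipR rfl fun p hp s hs hx => ?_,
    fun p hp s hs => ?_⟩
  · rw [ephi_eq (hz p hp)]
    exact mul_ne_zero hp.2 (h.ephi_ne _ hp.1)
  · rw [ephi_eq (hz p hp), hz p hp]
  · rw [(h.related p hp s hs).qbar_eq] at hx
    exact right_ne_zero_of_mul hx
  · have hr := h.related _ hp.1 s (hs.of_restrict scale_flipR fun p hp => hp.1)
    rw [scale_flipR] at hr
    have hs' := hs.mem_dom
    have hl := Complex.exp_ne_zero s
    have ha := Complex.exp_ne_zero (s * α)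
    have hb := Complex.exp_ne_zero (s * β)
    rw [mul_neg, Complex.exp_neg]
    refine ⟨?_, ?_, ?_⟩
    · refine hr.neg.GR1_mul (rescaleHom_cst _ _) (pow_ne_zero 2 ha) ?_
      rw [hr.qbar_eq, hr.zero]
      field_simp
    · rw [inv_pow]
      exact hr.pos.rightOne (rescaleHom_cst _ _) (pow_ne_zero 2 hb) hp.2 hr.qbar_eq
    · rw [ephi_eq (hz p hp), ephi_eq (hz _ hs'), hr.qbar_eq, hr.zero]
      field_simp

theorem Admissible.dynkin (h : g.Admissible α β) : (MPLR.dynkin g).Admissible (-α - 1 / 2) (-β - 1 / 2) := by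
  have hz : ∀ p ∈ (MPLR.dynkin g).dom, (MPLR.dynkin g).gzero p = diagInv ((g.ephi (-p))⁻¹) :=
      fun p hp => by
    simp only [MPLR.dynkin]
    rw [h.zero _ hp, dynkin_diagInv zetaPos_ne_zero]
  refine ⟨fun p hp => (h.neg _ hp).dynkin, fun p hp => (h.pos _ hp).dynkin,
    fun p hp => ?_, fun p hp => ?_, fun p hp => ?_,
    fun p hp s hs => ?_⟩
  · rw [ephi_eq (hz p hp)]
    exact inv_ne_zero (h.ephi_ne _ hp)
  · rw [ephi_eq (hz p hp), hz p hp]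
  · simpa only [MPLR.dynkin, Set.mem_ofPred_eq, ← scale_neg] using h.isOpen _ hp
  · have hr := h.related _ hp s (hs.of_restrict scale_neg fun p hp => hp)
    rw [scale_neg] at hr
    have hs' := hs.mem_dom
    have hl := Complex.exp_ne_zero s
    have ha := Complex.exp_ne_zero (s * α)
    have hb := Complex.exp_ne_zero (s * β)
    -- The shift by 1/2 becomes a full factor λ after squaring, while in the ratio `hy` it cancels.
    have hw : ∀ a, Complex.exp (s * (-a - 1 / 2)) ^ 2
        = (Complex.exp (s * a) ^ 2 * Complex.exp s)⁻¹ := fun a => by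
      rw [← Complex.exp_nat_mul, ← Complex.exp_nat_mul, ← Complex.exp_add, ← Complex.exp_neg]
      push_cast
      ring_nf
    have hy : Complex.exp (s * (-α - 1 / 2)) / Complex.exp (s * (-β - 1 / 2))
        = Complex.exp (s * β) / Complex.exp (s * α) := by
      rw [← Complex.exp_sub, ← Complex.exp_sub]
      ring_nf
    rw [hy]
    refine ⟨?_, ?_, ?_⟩
    · rw [hw]
      exact hr.neg.dynkin (rescaleHom_zetaNeg _ hl) zetaNeg_ne_zero (pow_ne_zero 2 ha) hl
    · rw [hw]
      exact hr.pos.dynkin (rescaleHom_zetaPos _ hl) zetaPos_ne_zero (pow_ne_zero 2 hb) hl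
    · rw [ephi_eq (hz p hp), ephi_eq (hz _ hs'), hr.zero]
      field_simp

/-! ### Uniqueness of the parameters -/

theorem Admissible.of_eq {α' β' : ℂ} (h : g.Admissible α β) (hα : α = α') (hβ : β = β') :
    g.Admissible α' β' := hα ▸ hβ ▸ h

theorem Admissible.eventually_related (h : g.Admissible α β) (hp : p ∈ g.dom) :
    ∀ᶠ s in nhds (0 : ℂ),
      g.Related (Complex.exp s) (Complex.exp_ne_zero s) (Complex.exp (s * α) ^ 2)
        (Complex.exp (s * β) ^ 2) (Complex.exp (s * α) / Complex.exp (s * β)) p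
        (scale (Complex.exp s) p) :=
  (h.isOpen.eventually_hasPath hp).mono fun s hs => h.related p hp s hs

variable {α' β' : ℂ}

/-- The nowhere vanishing e^φ has weight λ^{α-β}. -/
theorem Admissible.sub_eq_sub (h : g.Admissible α β) (h' : g.Admissible α' β') (hp : p ∈ g.dom) :
    α - β = α' - β' := by
  refine eq_of_eventually_exp_eq ?_
  filter_upwards [h.eventually_related hp, h'.eventually_related hp] with s hs hs'
  have hu := h.ephi_ne p hp
  rw [mul_sub, mul_sub, Complex.exp_sub, Complex.exp_sub]
  have e := hs.zero.symm.trans hs'.zero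
  rw [hs.zero] at hu
  exact mul_right_cancel₀ (right_ne_zero_of_mul hu) e

theorem eq_of_eventually_exp_sq_eq {a b : ℂ}
    (h : ∀ᶠ s in nhds (0 : ℂ), Complex.exp (s * a) ^ 2 = Complex.exp (s * b) ^ 2) : a = b := by
  refine mul_left_cancel₀ two_ne_zero (eq_of_eventually_exp_eq (a := 2 * a) (b := 2 * b) ?_)
  filter_upwards [h] with s hs
  simpa only [← Complex.exp_nat_mul, Nat.cast_ofNat, mul_left_comm s] using hs

theorem Admissible.eq_of_r_ne_zero (h : g.Admissible α β) (h' : g.Admissible α' β')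
    (hp : p ∈ g.dom) (hr : g.r p ≠ 0) : α' = α ∧ β' = β := by
  have e : α = α' := by
    refine eq_of_eventually_exp_sq_eq ?_
    filter_upwards [h.eventually_related hp, h'.eventually_related hp] with s hs hs'
    have e := hs.r_eq.symm.trans hs'.r_eq
    rw [hs.r_eq] at hr
    exact inv_injective (mul_right_cancel₀ (right_ne_zero_of_mul hr) e)
  have hs := h.sub_eq_sub h' hp
  exact ⟨e.symm, by rw [e] at hs; exact (sub_right_injective hs).symm⟩

theorem Admissible.eq_of_qbar_ne_zero (h : g.Admissible α β) (h' : g.Admissible α' β')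
    (hp : p ∈ g.dom) (hq : g.qbar p ≠ 0) : α' = α ∧ β' = β := by
  have e : β = β' := by
    refine eq_of_eventually_exp_sq_eq ?_
    filter_upwards [h.eventually_related hp, h'.eventually_related hp] with s hs hs'
    have e := hs.qbar_eq.symm.trans hs'.qbar_eq
    rw [hs.qbar_eq] at hq
    exact mul_right_cancel₀ (right_ne_zero_of_mul hq) e
  have hs := h.sub_eq_sub h' hp
  exact ⟨by rw [e] at hs; exact (sub_left_injective hs).symm, e.symm⟩

theorem Admissible.r_sL1_ne_zero (h : g.Admissible α β) (hp : p ∈ (MPLR.sL1 g).dom) :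
    (MPLR.sL1 g).r p ≠ 0 := by
  have h1 := ((h.neg _ hp.1).diag 1).1
  simp only [r, MPLR.sL1, leftOne_mul]
  simp only [Matrix.of_apply, Matrix.cons_val', Matrix.cons_val_zero, Matrix.cons_val_one,
    Matrix.cons_val_fin_one, coeff_cst_mul, h1]
  simpa [r] using hp.2

theorem Admissible.qbar_sR1_ne_zero (h : g.Admissible α β) (hp : p ∈ (MPLR.sR1 g).dom) :
    (MPLR.sR1 g).qbar p ≠ 0 := by
  have h0 := ((h.pos _ hp.1).diag 0).1
  simp only [qbar, MPLR.sR1, rightOne_mul]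
  simp only [Matrix.of_apply, Matrix.cons_val', Matrix.cons_val_zero, Matrix.cons_val_one,
    Matrix.cons_val_fin_one, HahnSeries.coeff_neg, coeff_cst_mul, h0]
  simpa [qbar] using hp.2

/-- s₀ᴸ turns q into -1/q, and π turns q into -r, so the resulting r is 1/q at the original time. -/
theorem Admissible.r_dynkin_sL0_ne_zero (h : g.Admissible α β)
    (hp : p ∈ (MPLR.dynkin (MPLR.sL0 g)).dom) : (MPLR.dynkin (MPLR.sL0 g)).r p ≠ 0 := by
  have h0 := ((h.neg _ hp.1).diag 0).1
  simp only [r, MPLR.dynkin, Pmat_conj zetaNeg_ne_zero, MPLR.sL0, leftZero_mul _ zetaNeg_ne_zero]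
  simp only [Matrix.of_apply, Matrix.cons_val', Matrix.cons_val_zero, Matrix.cons_val_one,
    Matrix.cons_val_fin_one, HahnSeries.coeff_neg, coeff_zetaNeg_mul, coeff_zetaNeg_inv_mul,
    coeff_cst_mul]
  simpa [h0] using hp.2

end Data

/-! ### The four shift operators -/

theorem shiftsParametersBy_of_admissible {T : Data → Data} {a b : ℂ}
    (hT : ∀ {g : Data} {α β : ℂ}, g.Admissible α β → (T g).Admissible (α + a) (β + b))
    (hu : ∀ {g : Data} {α β α' β' α₁ β₁ : ℂ} {p : Times}, g.Admissible α₁ β₁ → p ∈ (T g).dom →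
      (T g).Admissible α β → (T g).Admissible α' β' → α' = α ∧ β' = β) :
    ShiftsParametersBy T a b := by
  intro g α β hg ho hs
  have h := Data.admissible_iff.2 ⟨hg, ho, hs⟩
  obtain ⟨hg', ho', hs'⟩ := Data.admissible_iff.1 (hT h)
  exact ⟨hg', ho', hs', fun ⟨p, hp⟩ α' β' h' =>
    hu h hp (hT h) (Data.admissible_iff.2 ⟨hg', ho', h'⟩)⟩

theorem shiftsParametersBy_TL : ShiftsParametersBy TL 1 0 := by
  refine shiftsParametersBy_of_admissible (fun h => h.sL0.sL1.of_eq ?_ ?_) (fun h hp h₁ h₂ =>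
    h₁.eq_of_r_ne_zero h₂ hp (h.sL0.r_sL1_ne_zero hp)) <;> ring

theorem shiftsParametersBy_TR : ShiftsParametersBy TR 0 1 := by
  refine shiftsParametersBy_of_admissible (fun h => h.sR0.sR1.of_eq ?_ ?_) (fun h hp h₁ h₂ =>
    h₁.eq_of_qbar_ne_zero h₂ hp (h.sR0.qbar_sR1_ne_zero hp)) <;> ring

theorem shiftsParametersBy_T1 : ShiftsParametersBy T1 (1 / 2) (1 / 2) := by
  refine shiftsParametersBy_of_admissible (fun h => h.sR0.sL0.dynkin.of_eq ?_ ?_) (fun h hp h₁ h₂ =>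
    h₁.eq_of_r_ne_zero h₂ hp (h.sR0.r_dynkin_sL0_ne_zero hp)) <;> ring

theorem shiftsParametersBy_T2 : ShiftsParametersBy T2 (1 / 2) (-1 / 2) := by
  refine shiftsParametersBy_of_admissible (fun h => h.sR1.sL0.dynkin.of_eq ?_ ?_) (fun h hp h₁ h₂ =>
    h₁.eq_of_r_ne_zero h₂ hp (h.sR1.r_dynkin_sL0_ne_zero hp)) <;> ring

end MPLR

end

theorem corollary1 :
    MPLR.ShiftsParametersBy MPLR.TL 1 0 ∧
    MPLR.ShiftsParametersBy MPLR.TR 0 1 ∧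
    MPLR.ShiftsParametersBy MPLR.T1 (1 / 2) (1 / 2) ∧
    MPLR.ShiftsParametersBy MPLR.T2 (1 / 2) (-1 / 2) :=
  ⟨MPLR.shiftsParametersBy_TL, MPLR.shiftsParametersBy_TR, MPLR.shiftsParametersBy_T1,
    MPLR.shiftsParametersBy_T2⟩
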